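/- Let $\mathcal A$, $\mathcal B$ be $\mathbf C$-linear abelian categories of finite type, i.e. all extension groups $\mathrm{Ext}^n(X,Y)$, $n\ge 0$, between two objects are finite-dimensional over $\mathbf C$. For objects $A,B,C$ of such a category let $$G_{AB}^C=\{A'\subseteq C:\ A'\simeq A,\ C/A'\simeq B\},$$ a set of subobjects of $C$. It carries the following structure of a complex variety (regarded as a set of points with its Zariski topology and its sheaf of $\mathbf C$-valued regular functions). Let $E_{AB}^C\subseteq \mathrm{Hom}(A,C)\oplus\mathrm{Hom}(C,B)$ be the set of pairs $(\alpha,\beta)$ for which $0\to A\xrightarrow{\alpha}C\xrightarrow{\beta}B\to 0$ is exact, with the structure of a subvariety of this finite-dimensional vector space (the induced Zariski topology, and the functions which are locally quotients of polynomial functions). The map $(\alpha,\beta)\mapsto \mathrm{Im}(\alpha)$ identifies $G_{AB}^C$ with the quotient of $E_{AB}^C$ by the free action of $\mathrm{Aut}(A)\times\mathrm{Aut}(B)$, and $G_{AB}^C$ has the quotient structure: the quotient topology, and as regular functions on an open set those functions whose pullback to $E_{AB}^C$ is regular. Let $F:D^b(\mathcal A)\to D^b(\mathcal B)$ be a $\mathbf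 C$-linear equivalence of triangulated categories, and regard $\mathcal A$ and $\mathcal B$ as full subcategories of $D^b(\mathcal A)$ and $D^b(\mathcal B)$ (complexes concentrated in degree $0$, up to isomorphism). Let $A,B,C$ be objects of $\mathcal A$ such that $F(A)$ and $F(B)$ lie in $\mathcal B$ and $G_{AB}^C\neq\emptyset$. Then $F(C)$ lies in $\mathcal B$, and $F$ induces an isomorphism of complex varieties $$G_{AB}^C\longrightarrow G_{F(A),F(B)}^{F(C)},\qquad (A'\hookrightarrow C)\longmapsto (F(A')\hookrightarrow F(C)).$$ More precisely, for all objects $A_1,B_1,C_1$ of $\mathcal B$ with isomorphisms $F(A)\simeq A_1$, $F(B)\simeq B_1$ and $\varepsilon:F(C)\simeq C_1$ in $D^b(\mathcal B)$, there is an isomorphism of complex varieties $\Phi:G_{AB}^C\to G_{A_1B_1}^{C_1}$ such that for every $A'\in G_{AB}^C$, with inclusion $i:A'\hookrightarrow C$, the morphism $\varepsilon\circ F(i)$ is, up to an isomorphism $F(A')\simeq\Phi(A')$, the inclusion of $\Phi(A')$ in $C_1$. -/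

import Mathlib

open CategoryTheory CategoryTheory.Limits
open scoped Topology

universe w₁ w₂ v₁ v₂ u₁ u₂

namespace HallVariety

/-! ### Complex varieties as spaces with functions

A complex variety is viewed as the set of its complex points, with its Zariski topology and its
sheaf of regular functions, a sheaf of algebras of `ℂ`-valued functions. A morphism of varieties is
a continuous map which pulls regular functions back to regular functions. -/

/-- A topology on `X` together with a sheaf of algebras of `ℂ`-valued functions. The values of
`regular` matter only on open sets. -/
structure SpaceWithFunctions (X : Type*) where
  /-- the topology -/
  top : TopologicalSpace X
  /-- the regular functions on the open set `U` -/
  regular (U : Set X) : Subalgebra ℂ (U → ℂ)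
  regular_restrict : ∀ {U V : Set X} (h : V ⊆ U), IsOpen[top] U → IsOpen[top] V →
    ∀ f ∈ regular U, f ∘ Set.inclusion h ∈ regular V
  regular_of_locally : ∀ {U : Set X} (f : U → ℂ), IsOpen[top] U →
    (∀ x ∈ U, ∃ (V : Set X) (h : V ⊆ U), IsOpen[top] V ∧ x ∈ V ∧
      f ∘ Set.inclusion h ∈ regular V) → f ∈ regular U

namespace SpaceWithFunctions

/-- Morphisms: continuous maps along which regular functions pull back to regular functions. -/
def IsMorphism {X Y : Type*} (S : SpaceWithFunctions X) (T : SpaceWithFunctions Y)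
    (φ : X → Y) : Prop :=
  Continuous[S.top, T.top] φ ∧
    ∀ V : Set Y, IsOpen[T.top] V → ∀ f ∈ T.regular V,
      f ∘ V.restrictPreimage φ ∈ S.regular (φ ⁻¹' V)

/-- Isomorphisms: bijections that are morphisms in both directions. -/
def IsIsomorphism {X Y : Type*} (S : SpaceWithFunctions X) (T : SpaceWithFunctions Y)
    (φ : X ≃ Y) : Prop :=
  IsMorphism S T φ ∧ IsMorphism T S φ.symm

/-- The structure induced on (the source of an injection onto) a subset: the subspace topology, and
the functions which locally extend to regular functions of the ambient space. For a locally closed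
subset of a variety this is the usual structure of (reduced) subvariety. -/
def induced {X Y : Type*} (T : SpaceWithFunctions Y) (ι : X → Y) : SpaceWithFunctions X where
  top := T.top.induced ι
  regular U :=
    { carrier := {f | ∀ x : U, ∃ W : Set Y, IsOpen[T.top] W ∧ ι x ∈ W ∧ ∃ g ∈ T.regular W,
        ∀ (y : U) (hy : ι y ∈ W), f y = g ⟨ι y, hy⟩}
      mul_mem' := by
        intro f₁ f₂ h₁ h₂ x
        obtain ⟨W₁, o₁, m₁, g₁, r₁, e₁⟩ := h₁ x
        obtain ⟨W₂, o₂, m₂, g₂, r₂, e₂⟩ := h₂ x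
        have o := @IsOpen.inter _ T.top _ _ o₁ o₂
        refine ⟨W₁ ∩ W₂, o, ⟨m₁, m₂⟩, _,
          mul_mem (T.regular_restrict Set.inter_subset_left o₁ o g₁ r₁)
            (T.regular_restrict Set.inter_subset_right o₂ o g₂ r₂), fun y hy => ?_⟩
        rw [Pi.mul_apply, e₁ y hy.1, e₂ y hy.2]
        rfl
      add_mem' := by
        intro f₁ f₂ h₁ h₂ x
        obtain ⟨W₁, o₁, m₁, g₁, r₁, e₁⟩ := h₁ x
        obtain ⟨W₂, o₂, m₂, g₂, r₂, e₂⟩ := h₂ x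
        have o := @IsOpen.inter _ T.top _ _ o₁ o₂
        refine ⟨W₁ ∩ W₂, o, ⟨m₁, m₂⟩, _,
          add_mem (T.regular_restrict Set.inter_subset_left o₁ o g₁ r₁)
            (T.regular_restrict Set.inter_subset_right o₂ o g₂ r₂), fun y hy => ?_⟩
        rw [Pi.add_apply, e₁ y hy.1, e₂ y hy.2]
        rfl
      algebraMap_mem' := fun c x =>
        ⟨Set.univ, @isOpen_univ _ T.top, trivial, _, (T.regular Set.univ).algebraMap_mem c,
          fun _ _ => rfl⟩ }
  regular_restrict := by
    intro U V h _ _ f hf x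
    obtain ⟨W, o, m, g, r, e⟩ := hf (Set.inclusion h x)
    exact ⟨W, o, m, g, r, fun y hy => e (Set.inclusion h y) hy⟩
  regular_of_locally := by
    intro U f _ hf x
    obtain ⟨V, h, ⟨W', o', rfl⟩, m', hV⟩ := hf x x.2
    obtain ⟨W, o, m, g, r, e⟩ := hV ⟨x, m'⟩
    have oo := @IsOpen.inter _ T.top _ _ o o'
    exact ⟨W ∩ W', oo, ⟨m, m'⟩, _, T.regular_restrict Set.inter_subset_left o oo g r,
      fun y hy => e ⟨y, hy.2⟩ hy.1⟩

/-- The quotient structure along a map `π` (used for surjective `π`): the quotient topology, and the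
functions on `U` whose pullback to `π ⁻¹ U` is regular. -/
def quotient {X Y : Type*} (S : SpaceWithFunctions X) (π : X → Y) : SpaceWithFunctions Y where
  top := S.top.coinduced π
  regular U :=
    { carrier := {f | f ∘ U.restrictPreimage π ∈ S.regular (π ⁻¹' U)}
      mul_mem' := fun h₁ h₂ => (S.regular _).mul_mem h₁ h₂
      add_mem' := fun h₁ h₂ => (S.regular _).add_mem h₁ h₂
      algebraMap_mem' := fun c => (S.regular _).algebraMap_mem c }
  regular_restrict := fun h oU oV _ hf =>
    S.regular_restrict (Set.preimage_mono (f := π) h) oU oV _ hf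
  regular_of_locally := by
    intro U f oU hf
    refine S.regular_of_locally _ oU fun x hx => ?_
    obtain ⟨V, h, oV, m, hV⟩ := hf (π x) hx
    exact ⟨π ⁻¹' V, Set.preimage_mono h, oV, m, hV⟩

section AffineSpace

variable (V : Type*) [AddCommGroup V] [Module ℂ V]

/-- Polynomial functions on a (finite-dimensional) complex vector space: the algebra of functions
generated by the linear functionals. -/
def polynomialFunctions : Subalgebra ℂ (V → ℂ) :=
  Algebra.adjoin ℂ (Set.range fun φ : Module.Dual ℂ V => (φ : V → ℂ))

/-- The Zariski topology: the principal open sets `{q ≠ 0}`, `q` polynomial, form a basis. -/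
@[reducible] def zariskiTopology : TopologicalSpace V :=
  TopologicalSpace.generateFrom {D | ∃ q ∈ polynomialFunctions V, D = {x | q x ≠ 0}}

/-- A finite-dimensional complex vector space as an affine algebraic variety: regular functions are
those which are locally quotients `p / q` of polynomial functions. -/
def affineSpace : SpaceWithFunctions V where
  top := zariskiTopology V
  regular U :=
    { carrier := {f | ∀ x : U, ∃ W : Set V, IsOpen[zariskiTopology V] W ∧ (x : V) ∈ W ∧
        ∃ p ∈ polynomialFunctions V, ∃ q ∈ polynomialFunctions V,
          ∀ y : U, (y : V) ∈ W → q y ≠ 0 ∧ f y = p y / q y}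
      mul_mem' := by
        intro f₁ f₂ h₁ h₂ x
        obtain ⟨W₁, o₁, m₁, p₁, hp₁, q₁, hq₁, e₁⟩ := h₁ x
        obtain ⟨W₂, o₂, m₂, p₂, hp₂, q₂, hq₂, e₂⟩ := h₂ x
        refine ⟨W₁ ∩ W₂, @IsOpen.inter _ (zariskiTopology V) _ _ o₁ o₂, ⟨m₁, m₂⟩, _,
          mul_mem hp₁ hp₂, _, mul_mem hq₁ hq₂, fun y hy => ?_⟩
        obtain ⟨n₁, d₁⟩ := e₁ y hy.1
        obtain ⟨n₂, d₂⟩ := e₂ y hy.2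
        refine ⟨mul_ne_zero n₁ n₂, ?_⟩
        simp only [Pi.mul_apply, d₁, d₂]
        field_simp
      add_mem' := by
        intro f₁ f₂ h₁ h₂ x
        obtain ⟨W₁, o₁, m₁, p₁, hp₁, q₁, hq₁, e₁⟩ := h₁ x
        obtain ⟨W₂, o₂, m₂, p₂, hp₂, q₂, hq₂, e₂⟩ := h₂ x
        refine ⟨W₁ ∩ W₂, @IsOpen.inter _ (zariskiTopology V) _ _ o₁ o₂, ⟨m₁, m₂⟩, _,
          add_mem (mul_mem hp₁ hq₂) (mul_mem hp₂ hq₁), _, mul_mem hq₁ hq₂, fun y hy => ?_⟩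
        obtain ⟨n₁, d₁⟩ := e₁ y hy.1
        obtain ⟨n₂, d₂⟩ := e₂ y hy.2
        refine ⟨mul_ne_zero n₁ n₂, ?_⟩
        simp only [Pi.add_apply, Pi.mul_apply, d₁, d₂]
        field_simp
      algebraMap_mem' := fun c x =>
        ⟨Set.univ, @isOpen_univ _ (zariskiTopology V), trivial, _,
          (polynomialFunctions V).algebraMap_mem c, 1, one_mem _,
          fun y _ => ⟨one_ne_zero, by simp⟩⟩ }
  regular_restrict := by
    intro U V' h _ _ f hf x
    obtain ⟨W, o, m, p, hp, q, hq, e⟩ := hf (Set.inclusion h x)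
    exact ⟨W, o, m, p, hp, q, hq, fun y hy => e (Set.inclusion h y) hy⟩
  regular_of_locally := by
    intro U f _ hf x
    obtain ⟨V', h, o', m', hV⟩ := hf x x.2
    obtain ⟨W, o, m, p, hp, q, hq, e⟩ := hV ⟨x, m'⟩
    exact ⟨W ∩ V', @IsOpen.inter _ (zariskiTopology V) _ _ o o', ⟨m, m'⟩, p, hp, q, hq,
      fun y hy => e ⟨y, hy.2⟩ hy.1⟩

end AffineSpace

end SpaceWithFunctions

/-! ### The varieties `G_{AB}^C` -/

section HallSets

variable {𝒜 : Type u₁} [Category.{v₁} 𝒜] [Abelian 𝒜]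

/-- The set `G_{AB}^C` of subobjects `A' ⊆ C` with `A' ≅ A` and `C / A' ≅ B`. -/
def G (A B C : 𝒜) : Type (max u₁ v₁) :=
  {S : Subobject C // Nonempty ((S : 𝒜) ≅ A) ∧ Nonempty (cokernel S.arrow ≅ B)}

/-- The set `E_{AB}^C` of pairs `(α, β)` for which `0 ⟶ A ⟶ C ⟶ B ⟶ 0` is exact. -/
def E (A B C : 𝒜) : Type v₁ :=
  {p : (A ⟶ C) × (C ⟶ B) // ∃ w : p.1 ≫ p.2 = 0, (ShortComplex.mk p.1 p.2 w).ShortExact}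

/-- The map `E_{AB}^C → G_{AB}^C` which sends an exact sequence `(α, β)` to the image of `α`. -/
noncomputable def E.toG {A B C : 𝒜} (p : E A B C) : G A B C :=
  haveI : Mono p.1.1 := p.2.choose_spec.mono_f
  haveI : Epi p.1.2 := p.2.choose_spec.epi_g
  ⟨Subobject.mk p.1.1, ⟨Subobject.underlyingIso p.1.1⟩,
    ⟨cokernelIsoOfEq (Subobject.underlyingIso_hom_comp_eq_mk p.1.1).symm ≪≫
      cokernelEpiComp (Subobject.underlyingIso p.1.1).hom p.1.1 ≪≫
      (cokernelIsCokernel p.1.1).coconePointUniqueUpToIso p.2.choose_spec.gIsCokernel⟩⟩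

/-- Every element of `G_{AB}^C` comes from an exact sequence. -/
theorem E.toG_surjective (A B C : 𝒜) : Function.Surjective (E.toG : E A B C → G A B C) := by
  rintro ⟨S, ⟨a⟩, ⟨b⟩⟩
  have w : (a.inv ≫ S.arrow) ≫ (cokernel.π S.arrow ≫ b.hom) = 0 := by simp
  have h₀ : (ShortComplex.mk S.arrow (cokernel.π S.arrow) (by simp)).ShortExact :=
    { exact := ShortComplex.exact_of_g_is_cokernel _ (cokernelIsCokernel S.arrow) }
  have h : (ShortComplex.mk (a.inv ≫ S.arrow) (cokernel.π S.arrow ≫ b.hom) w).ShortExact :=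
    ShortComplex.shortExact_of_iso (S₁ := ShortComplex.mk S.arrow (cokernel.π S.arrow) (by simp))
      (ShortComplex.isoMk a (Iso.refl _) b (by simp) (by simp)) h₀
  refine ⟨⟨(a.inv ≫ S.arrow, cokernel.π S.arrow ≫ b.hom), w, h⟩, Subtype.ext ?_⟩
  exact (Subobject.mk_eq_of_comm _ a.symm (by simp))

/-- The fibres of `E_{AB}^C → G_{AB}^C` are the orbits of `Aut A × Aut B`, so that `G_{AB}^C` is, as
a set, the quotient of `E_{AB}^C` by this group. -/
theorem E.toG_eq_iff {A B C : 𝒜} (p q : E A B C) :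
    p.toG = q.toG ↔ ∃ (a : A ≅ A) (b : B ≅ B), q.1 = (a.hom ≫ p.1.1, p.1.2 ≫ b.hom) := by
  obtain ⟨⟨α, β⟩, w, h⟩ := p
  obtain ⟨⟨α', β'⟩, w', h'⟩ := q
  dsimp only at w h w' h'
  have : Mono α := h.mono_f
  have : Mono α' := h'.mono_f
  constructor
  · intro e
    have e' : Subobject.mk α = Subobject.mk α' := congrArg Subtype.val e
    let a : A ≅ A := Subobject.isoOfMkEqMk α' α e'.symm
    have ha : a.hom ≫ α = α' := by simp [a]
    have hc := h.gIsCokernel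
    have hc' := h'.gIsCokernel
    have w₁ : α ≫ β' = 0 := by
      rw [← cancel_epi a.hom, ← Category.assoc, ha, w', comp_zero]
    have w₂ : α' ≫ β = 0 := by
      rw [← ha, Category.assoc, w, comp_zero]
    obtain ⟨f, hf⟩ := CokernelCofork.IsColimit.desc' hc β' w₁
    obtain ⟨g, hg⟩ := CokernelCofork.IsColimit.desc' hc' β w₂
    change β ≫ f = β' at hf
    change β' ≫ g = β at hg
    have : Epi β := h.epi_g
    have : Epi β' := h'.epi_g
    refine ⟨a, ⟨f, g, ?_, ?_⟩, ?_⟩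
    · rw [← cancel_epi β, ← Category.assoc, hf, hg, Category.comp_id]
    · rw [← cancel_epi β', ← Category.assoc, hg, hf, Category.comp_id]
    · exact Prod.ext ha.symm hf.symm
  · rintro ⟨a, b, e⟩
    have e₁ : α' = a.hom ≫ α := congrArg Prod.fst e
    exact Subtype.ext (Subobject.mk_eq_mk_of_comm _ _ a.symm (by simp [e₁]))

variable [Linear ℂ 𝒜]

/-- `E_{AB}^C` as a (locally closed) subvariety of the vector space `Hom(A, C) ⊕ Hom(C, B)`. -/
def E.variety (A B C : 𝒜) : SpaceWithFunctions (E A B C) :=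
  (SpaceWithFunctions.affineSpace ((A ⟶ C) × (C ⟶ B))).induced Subtype.val

/-- The variety `G_{AB}^C`: the quotient of `E_{AB}^C` by `Aut A × Aut B`. -/
noncomputable def G.variety (A B C : 𝒜) : SpaceWithFunctions (G A B C) :=
  (E.variety A B C).quotient E.toG

variable (𝒜) in
/-- A `ℂ`-linear abelian category is of finite type if all its extension groups `Ext^n(X, Y)`,
`n ≥ 0`, are finite-dimensional. -/
def IsFiniteType : Prop :=
  haveI := HasExt.standard 𝒜
  ∀ (X Y : 𝒜) (n : ℕ), Module.Finite ℂ (Abelian.Ext.{max u₁ v₁} X Y n)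

end HallSets

/-! ### The embedding of an abelian category in its bounded derived category -/

/-- The functor `𝒜 ⥤ D^b(𝒜)` which sends an object to the complex concentrated in degree `0`. -/
noncomputable def toDb (𝒜 : Type u₁) [Category.{v₁} 𝒜] [Abelian 𝒜] [HasDerivedCategory.{w₁} 𝒜] :
    𝒜 ⥤ DerivedCategory.Bounded 𝒜 :=
  ObjectProperty.lift _ (DerivedCategory.singleFunctor 𝒜 0)
    fun _ => ⟨⟨0, inferInstance⟩, ⟨0, inferInstance⟩⟩

end HallVariety

open HallVariety

/-! A short exact sequence in an abelian category is the same thing as a composable pair of its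
morphisms that can be completed to a distinguished triangle in the derived category
(`extendsToTriangle_toDb_iff`). A fully faithful triangulated functor preserves and reflects such
pairs (`extendsToTriangle_map_iff`). Complexes with cohomology only in degree 0 are closed under
extensions, so F(C) lies in ℬ.

Since F and the embeddings `toDb` are fully faithful and ℂ-linear, Hom(A, C) ⊕ Hom(C, B) is linearly
isomorphic to its counterpart in ℬ. This isomorphism matches the two sets of exact sequences
(`shortExact_transport_iff`), hence is an isomorphism of the varieties E. By functoriality it also
matches the orbits of the automorphism groups (`E.toG_equiv_eq_iff`), so it descends to an
isomorphism of the quotients G. -/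

namespace HallVariety

/-! ### Functoriality of spaces with functions -/

namespace SpaceWithFunctions

/-- A local extension of a function to the ambient space pulls back along `ψ` to a local extension
of the pulled-back function. -/
theorem IsMorphism.induced {X Y X' Y' : Type*} {T : SpaceWithFunctions Y}
    {T' : SpaceWithFunctions Y'} {ι : X → Y} {ι' : X' → Y'} {ψ : Y → Y'} (hψ : IsMorphism T T' ψ)
    (φ : X → X') (hφ : ∀ x, ι' (φ x) = ψ (ι x)) :
    IsMorphism (T.induced ι) (T'.induced ι') φ := by
  refine ⟨?_, ?_⟩
  · refine (@continuous_def _ _ (T.induced ι).top (T'.induced ι').top φ).2 ?_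
    rintro _ ⟨W, oW, rfl⟩
    refine ⟨ψ ⁻¹' W, (@continuous_def _ _ T.top T'.top ψ).1 hψ.1 W oW, ?_⟩
    ext x
    simp [hφ]
  · intro V _ f hf x
    obtain ⟨W, oW, mW, g, hg, e⟩ := hf ⟨φ x, x.2⟩
    refine ⟨ψ ⁻¹' W, (@continuous_def _ _ T.top T'.top ψ).1 hψ.1 W oW, ?_,
      g ∘ W.restrictPreimage ψ, hψ.2 W oW g hg, fun y hy => ?_⟩
    · simpa [hφ] using mW
    · refine (e ⟨φ y, y.2⟩ (by simpa [hφ] using hy)).trans ?_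
      exact congrArg g (Subtype.ext (hφ y))

/-- Openness and regularity on a quotient are tested after pullback along `π`, and the commuting
square turns that test into one for `φ`. -/
theorem IsMorphism.quotient {X Y X' Y' : Type*} {S : SpaceWithFunctions X}
    {S' : SpaceWithFunctions X'} {π : X → Y} {π' : X' → Y'} {φ : X → X'} (hφ : IsMorphism S S' φ)
    (ψ : Y → Y') (hψ : ∀ x, ψ (π x) = π' (φ x)) :
    IsMorphism (S.quotient π) (S'.quotient π') ψ := by
  have key (V : Set Y') : π ⁻¹' (ψ ⁻¹' V) = φ ⁻¹' (π' ⁻¹' V) := by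
    ext x
    simp [hψ]
  refine ⟨?_, ?_⟩
  · refine (@continuous_def _ _ (S.quotient π).top (S'.quotient π').top ψ).2 fun V oV => ?_
    change IsOpen[S.top] (π ⁻¹' (ψ ⁻¹' V))
    rw [key]
    exact (@continuous_def _ _ S.top S'.top φ).1 hφ.1 _ oV
  · intro V oV f hf
    have h := hφ.2 _ oV _ hf
    change _ ∈ S.regular (π ⁻¹' (ψ ⁻¹' V))
    -- The preimages of `V` along the two sides of the square are equal sets but not definitionally
    -- so, and functions on them have different types. Generalising the set lets the equality be
    -- substituted.
    suffices ∀ (U : Set X) (hU : U = φ ⁻¹' (π' ⁻¹' V)) (f' : U → ℂ),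
        (∀ x : U, f' x = f ⟨π' (φ x), hU.subset x.2⟩) →
          f' ∈ S.regular U by
      refine this _ (key V) _ fun x => ?_
      exact congrArg f (Subtype.ext (hψ x))
    rintro _ rfl f' hf'
    convert h using 1
    exact funext hf'

variable {V V' : Type*} [AddCommGroup V] [Module ℂ V] [AddCommGroup V'] [Module ℂ V']

theorem comp_mem_polynomialFunctions (L : V →ₗ[ℂ] V') {q : V' → ℂ}
    (hq : q ∈ polynomialFunctions V') : q ∘ L ∈ polynomialFunctions V := by
  induction hq using Algebra.adjoin_induction with
  | mem _ h =>
    obtain ⟨φ, rfl⟩ := h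
    exact Algebra.subset_adjoin ⟨φ.comp L, rfl⟩
  | algebraMap r => exact (polynomialFunctions V).algebraMap_mem r
  | add _ _ _ _ h₁ h₂ => exact add_mem h₁ h₂
  | mul _ _ _ _ h₁ h₂ => exact mul_mem h₁ h₂

theorem isMorphism_linearMap (L : V →ₗ[ℂ] V') :
    IsMorphism (affineSpace V) (affineSpace V') L := by
  have hL : Continuous[zariskiTopology V, zariskiTopology V'] L := by
    refine (@continuous_generateFrom_iff _ _ _ (zariskiTopology V) _).2 ?_
    rintro _ ⟨q, hq, rfl⟩
    exact TopologicalSpace.isOpen_generateFrom_of_mem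
      ⟨q ∘ L, comp_mem_polynomialFunctions L hq, rfl⟩
  refine ⟨hL, fun U _ f hf x => ?_⟩
  obtain ⟨W, oW, mW, p, hp, q, hq, e⟩ := hf ⟨L x, x.2⟩
  exact ⟨L ⁻¹' W, (@continuous_def _ _ (zariskiTopology V) (zariskiTopology V') L).1 hL W oW, mW,
    p ∘ L, comp_mem_polynomialFunctions L hp, q ∘ L, comp_mem_polynomialFunctions L hq,
    fun y hy => e ⟨L y, y.2⟩ hy⟩

end SpaceWithFunctions

/-! ### Pairs of morphisms which extend to a distinguished triangle -/

section Triangles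

open Pretriangulated

/-- `X ⟶ Y ⟶ Z` extends to a distinguished triangle. -/
def ExtendsToTriangle {D : Type*} [Category* D] [HasZeroObject D] [HasShift D ℤ] [Preadditive D]
    [∀ n : ℤ, (shiftFunctor D n).Additive] [Pretriangulated D] {X Y Z : D}
    (f : X ⟶ Y) (g : Y ⟶ Z) : Prop :=
  ∃ h : Z ⟶ X⟦(1 : ℤ)⟧, Triangle.mk f g h ∈ distTriang D

variable {D : Type*} [Category* D] [HasZeroObject D] [HasShift D ℤ] [Preadditive D]
    [∀ n : ℤ, (shiftFunctor D n).Additive] [Pretriangulated D]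

theorem ExtendsToTriangle.of_iso {X Y Z X' Y' Z' : D} {f : X ⟶ Y} {g : Y ⟶ Z} {f' : X' ⟶ Y'}
    {g' : Y' ⟶ Z'} (H : ExtendsToTriangle f g) (eX : X ≅ X') (eY : Y ≅ Y') (eZ : Z ≅ Z')
    (hf : f ≫ eY.hom = eX.hom ≫ f') (hg : g ≫ eZ.hom = eY.hom ≫ g') :
    ExtendsToTriangle f' g' := by
  obtain ⟨h, H⟩ := H
  refine ⟨eZ.inv ≫ h ≫ eX.hom⟦(1 : ℤ)⟧', ?_⟩
  exact isomorphic_distinguished _ H _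
    (Triangle.isoMk _ _ eX eY eZ hf hg (Iso.hom_inv_id_assoc _ _).symm).symm

/-- Fullness lifts the connecting morphism, once its target (F X)[1] is identified with F(X[1]). The
lemma serves both for the equivalence and for the inclusion of the bounded derived category. -/
theorem extendsToTriangle_map_iff {D' : Type*} [Category* D'] [HasZeroObject D'] [HasShift D' ℤ]
    [Preadditive D'] [∀ n : ℤ, (shiftFunctor D' n).Additive] [Pretriangulated D']
    (F : D ⥤ D') [F.CommShift ℤ] [F.IsTriangulated] [F.Full] [F.Faithful]
    {X Y Z : D} (f : X ⟶ Y) (g : Y ⟶ Z) :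
    ExtendsToTriangle (F.map f) (F.map g) ↔ ExtendsToTriangle f g := by
  constructor
  · rintro ⟨h, H⟩
    refine ⟨F.preimage (h ≫ (F.commShiftIso (1 : ℤ)).inv.app X), ?_⟩
    rw [← F.map_distinguished_iff]
    have comm₃ : (F.map (F.preimage (h ≫ (F.commShiftIso (1 : ℤ)).inv.app X)) ≫
        (F.commShiftIso (1 : ℤ)).hom.app X) ≫ (𝟙 (F.obj X))⟦(1 : ℤ)⟧' = 𝟙 _ ≫ h := by simp
    exact isomorphic_distinguished _ H _
      (Triangle.isoMk _ _ (Iso.refl _) (Iso.refl _) (Iso.refl _)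
        ((Category.comp_id _).trans (Category.id_comp _).symm)
        ((Category.comp_id _).trans (Category.id_comp _).symm) comm₃)
  · rintro ⟨h, H⟩
    exact ⟨_, F.map_distinguished _ H⟩

end Triangles

/-! ### Exact sequences and triangles in the derived category -/

section Derived

open DerivedCategory Pretriangulated

variable {𝒜 : Type u₁} [Category.{v₁} 𝒜] [Abelian 𝒜] [HasDerivedCategory.{w₁} 𝒜]

instance : (toDb 𝒜).Full := Functor.Full.of_comp_faithful_iso (G := Bounded.ι (C := 𝒜))
  (Iso.refl (singleFunctor 𝒜 0))
instance : (toDb 𝒜).Faithful := Functor.Faithful.of_comp_iso (G := Bounded.ι (C := 𝒜))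
  (Iso.refl (singleFunctor 𝒜 0))
instance [Linear ℂ 𝒜] : (toDb 𝒜).Linear ℂ where
  map_smul f r := by
    apply (Bounded.ι (C := 𝒜)).map_injective
    exact Functor.map_smul (singleFunctor 𝒜 0) r f
instance : (toDb 𝒜).Additive where
  map_add {_ _ f g} := by
    apply (Bounded.ι (C := 𝒜)).map_injective
    exact (singleFunctor 𝒜 0).map_add (f := f) (g := g)

/-- From a triangle, the long exact homology sequence around degree 0 gives exactness: the map on H⁰
is mono on the left because H⁻¹(Z) = 0 and epi on the right because H¹(X) = 0. Conversely, a short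
exact sequence has its canonical triangle. -/
theorem extendsToTriangle_toDb_iff {X Y Z : 𝒜} (f : X ⟶ Y) (g : Y ⟶ Z) :
    ExtendsToTriangle ((toDb 𝒜).map f) ((toDb 𝒜).map g) ↔
      ∃ w : f ≫ g = 0, (ShortComplex.mk f g w).ShortExact := by
  rw [← extendsToTriangle_map_iff (Bounded.ι (C := 𝒜))]
  change ExtendsToTriangle ((singleFunctor 𝒜 0).map f) ((singleFunctor 𝒜 0).map g) ↔ _
  constructor
  · rintro ⟨h, H⟩
    have w : f ≫ g = 0 := (singleFunctor 𝒜 0).map_injective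
      (((singleFunctor 𝒜 0).map_comp f g).trans
        ((comp_distTriang_mor_zero₁₂ _ H).trans ((singleFunctor 𝒜 0).map_zero _ _).symm))
    let e := singleFunctorCompHomologyFunctorIso 𝒜 0
    have hz (X : 𝒜) (n : ℤ) (hn : n ≠ 0) :
        IsZero ((homologyFunctor 𝒜 n).obj ((singleFunctor 𝒜 0).obj X)) := by
      rcases lt_or_gt_of_ne hn with hn | hn
      · exact isZero_of_isGE _ 0 _ hn
      · exact isZero_of_isLE _ 0 _ hn
    have ex := HomologySequence.exact₂ _ H 0
    have m : Mono ((homologyFunctor 𝒜 0).map ((singleFunctor 𝒜 0).map f)) :=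
      (HomologySequence.mono_homologyMap_mor₁_iff _ H (-1) 0).2
        ((hz _ _ (by simp)).eq_of_src _ _)
    have ep : Epi ((homologyFunctor 𝒜 0).map ((singleFunctor 𝒜 0).map g)) :=
      (HomologySequence.epi_homologyMap_mor₂_iff _ H 0 1).2
        ((hz _ _ (by simp)).eq_of_tgt _ _)
    refine ⟨w, ShortComplex.shortExact_of_iso (ShortComplex.isoMk (e.app _) (e.app _) (e.app _)
      (e.hom.naturality f).symm (e.hom.naturality g).symm) { exact := ex, mono_f := m, epi_g := ep }⟩
  · rintro ⟨w, h⟩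
    exact ⟨_, h.singleTriangle_distinguished⟩

theorem mem_essImage_toDb_iff (X : Bounded 𝒜) :
    (toDb 𝒜).essImage X ↔ X.obj.IsGE 0 ∧ X.obj.IsLE 0 := by
  constructor
  · rintro ⟨Y, ⟨e⟩⟩
    have e' : (singleFunctor 𝒜 0).obj Y ≅ X.obj := (Bounded.ι (C := 𝒜)).mapIso e
    exact ⟨TStructure.t.isGE_of_iso e' 0, TStructure.t.isLE_of_iso e' 0⟩
  · rintro ⟨_, _⟩
    obtain ⟨Y, ⟨e⟩⟩ := exists_iso_singleFunctor_obj_of_isGE_of_isLE X.obj 0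
    exact ⟨Y, ⟨(Bounded.ι (C := 𝒜)).preimageIso e.symm⟩⟩

/-- For i ≠ 0, Hⁱ(Y) sits in an exact sequence between Hⁱ(X) = 0 and Hⁱ(Z) = 0. -/
theorem ExtendsToTriangle.mem_essImage_toDb {X Y Z : Bounded 𝒜} {f : X ⟶ Y} {g : Y ⟶ Z}
    (H : ExtendsToTriangle f g) (hX : (toDb 𝒜).essImage X) (hZ : (toDb 𝒜).essImage Z) :
    (toDb 𝒜).essImage Y := by
  rw [← extendsToTriangle_map_iff (Bounded.ι (C := 𝒜))] at H
  obtain ⟨h, H⟩ := H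
  rw [mem_essImage_toDb_iff] at *
  simp only [isGE_iff, isLE_iff] at *
  exact ⟨fun i hi => (HomologySequence.exact₂ _ H i).isZero_of_both_zeros
      ((hX.1 i hi).eq_of_src _ _) ((hZ.1 i hi).eq_of_tgt _ _),
    fun i hi => (HomologySequence.exact₂ _ H i).isZero_of_both_zeros
      ((hX.2 i hi).eq_of_src _ _) ((hZ.2 i hi).eq_of_tgt _ _)⟩

end Derived

/-! ### Transport of morphisms along fully faithful functors -/

section Transport

variable {𝒜 : Type*} [Category* 𝒜] {ℬ : Type*} [Category* ℬ] {D : Type*} [Category* D]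
  (K : 𝒜 ⥤ D) (L : ℬ ⥤ D) [L.Full] {X Y Z : 𝒜} {X' Y' Z' : ℬ}

/-- The morphism `X' ⟶ Y'` corresponding to a morphism `X ⟶ Y` under isomorphisms
`K X ≅ L X'` and `K Y ≅ L Y'`. -/
noncomputable def transport (eX : K.obj X ≅ L.obj X') (eY : K.obj Y ≅ L.obj Y') (f : X ⟶ Y) :
    X' ⟶ Y' :=
  L.preimage (eX.inv ≫ K.map f ≫ eY.hom)

variable (eX : K.obj X ≅ L.obj X') (eY : K.obj Y ≅ L.obj Y') (eZ : K.obj Z ≅ L.obj Z')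

theorem comp_map_transport (f : X ⟶ Y) :
    eX.hom ≫ L.map (transport K L eX eY f) = K.map f ≫ eY.hom := by
  simp [transport]

theorem transport_comp [L.Faithful] (f : X ⟶ Y) (g : Y ⟶ Z) :
    transport K L eX eZ (f ≫ g) = transport K L eX eY f ≫ transport K L eY eZ g :=
  L.map_injective (by simp [transport])

theorem transport_id [L.Faithful] : transport K L eX eX (𝟙 X) = 𝟙 X' :=
  L.map_injective (by simp [transport])

/-- The isomorphism corresponding to an isomorphism. -/
noncomputable def transportIso [L.Faithful] (i : X ≅ Y) : X' ≅ Y' where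
  hom := transport K L eX eY i.hom
  inv := transport K L eY eX i.inv
  hom_inv_id := by rw [← transport_comp, i.hom_inv_id, transport_id]
  inv_hom_id := by rw [← transport_comp, i.inv_hom_id, transport_id]

/-- With the two functors exchanged, the same lemma provides the other inverse law in
`transportLinearEquiv`. -/
theorem transport_transport [K.Full] [K.Faithful] (f : X ⟶ Y) :
    transport L K eX.symm eY.symm (transport K L eX eY f) = f :=
  K.map_injective (by simp [transport])

/-- Transport of morphisms, as a linear equivalence. -/
noncomputable def transportLinearEquiv [K.Full] [K.Faithful] [L.Faithful] [Preadditive 𝒜] [Preadditive ℬ]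
    [Preadditive D] [Linear ℂ 𝒜] [Linear ℂ ℬ] [Linear ℂ D] [K.Additive] [L.Additive]
    [K.Linear ℂ] [L.Linear ℂ] : (X ⟶ Y) ≃ₗ[ℂ] (X' ⟶ Y') where
  toFun := transport K L eX eY
  invFun := transport L K eX.symm eY.symm
  map_add' f g := L.map_injective (by simp [transport])
  map_smul' r f := L.map_injective (by simp [transport])
  left_inv := transport_transport K L eX eY
  right_inv := transport_transport L K eX.symm eY.symm

end Transport

/-! ### The isomorphism induced by an equivalence -/

section Equivalence

open DerivedCategory

variable {𝒜 : Type u₁} [Category.{v₁} 𝒜] [Abelian 𝒜] [HasDerivedCategory.{w₁} 𝒜]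
  {ℬ : Type u₂} [Category.{v₂} ℬ] [Abelian ℬ] [HasDerivedCategory.{w₂} ℬ]
  (F : Bounded 𝒜 ⥤ Bounded ℬ) {A B C : 𝒜} {A' B' C' : ℬ}
  (eA : (toDb 𝒜 ⋙ F).obj A ≅ (toDb ℬ).obj A') (eB : (toDb 𝒜 ⋙ F).obj B ≅ (toDb ℬ).obj B')
  (eC : (toDb 𝒜 ⋙ F).obj C ≅ (toDb ℬ).obj C')

theorem shortExact_transport_iff [F.CommShift ℤ] [F.IsTriangulated] [F.Full] [F.Faithful]
    (f : A ⟶ C) (g : C ⟶ B) :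
    (∃ w : f ≫ g = 0, (ShortComplex.mk f g w).ShortExact) ↔
      ∃ w : transport _ _ eA eC f ≫ transport _ _ eC eB g = 0,
        (ShortComplex.mk (transport _ _ eA eC f) (transport _ _ eC eB g) w).ShortExact := by
  rw [← extendsToTriangle_toDb_iff, ← extendsToTriangle_toDb_iff, ← extendsToTriangle_map_iff F]
  have hf := comp_map_transport _ _ eA eC f
  have hg := comp_map_transport _ _ eC eB g
  constructor
  · exact fun H => H.of_iso eA eC eB hf.symm hg.symm
  · exact fun H => H.of_iso eA.symm eC.symm eB.symm
      ((eA.eq_inv_comp.2 ((Category.assoc _ _ _).symm.trans (eC.comp_inv_eq.2 hf))))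
      ((eC.eq_inv_comp.2 ((Category.assoc _ _ _).symm.trans (eB.comp_inv_eq.2 hg))))

variable [F.CommShift ℤ] [F.IsTriangulated] [F.Full] [F.Faithful]
  [Linear ℂ 𝒜] [Linear ℂ ℬ] [F.Linear ℂ]

/-- The linear isomorphism between the vector spaces containing the varieties of exact sequences. -/
noncomputable def pairEquiv :
    ((A ⟶ C) × (C ⟶ B)) ≃ₗ[ℂ] ((A' ⟶ C') × (C' ⟶ B')) :=
  (transportLinearEquiv _ _ eA eC).prodCongr (transportLinearEquiv _ _ eC eB)

/-- The induced bijection between the sets of exact sequences. -/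
noncomputable def E.equiv : E A B C ≃ E A' B' C' :=
  (pairEquiv F eA eB eC).toEquiv.subtypeEquiv fun p => shortExact_transport_iff F eA eB eC p.1 p.2

/-- Fibres of `E.toG` are orbits of Aut A × Aut B, and transport respects composition and carries
automorphisms of A and B bijectively to those of A' and B'. -/
theorem E.toG_equiv_eq_iff (p q : E A B C) :
    (E.equiv F eA eB eC p).toG = (E.equiv F eA eB eC q).toG ↔ p.toG = q.toG := by
  rw [E.toG_eq_iff, E.toG_eq_iff]
  constructor
  · rintro ⟨a, b, h⟩
    -- The automorphisms of A' and B' are transported back; injectivity of `pairEquiv` reduces the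
    -- claim to the given identity in ℬ.
    refine ⟨transportIso _ _ eA.symm eA.symm a, transportIso _ _ eB.symm eB.symm b,
      (pairEquiv F eA eB eC).injective (h.trans ?_)⟩
    refine Prod.ext ?_ ?_
    · refine Eq.trans ?_ (transport_comp _ _ eA eA eC _ _).symm
      exact congrArg (· ≫ _) (transport_transport _ _ eA.symm eA.symm a.hom).symm
    · refine Eq.trans ?_ (transport_comp _ _ eC eB eB _ _).symm
      exact congrArg (_ ≫ ·) (transport_transport _ _ eB.symm eB.symm b.hom).symm
  · rintro ⟨a, b, h⟩
    refine ⟨transportIso _ _ eA eA a, transportIso _ _ eB eB b,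
      (congrArg (pairEquiv F eA eB eC) h).trans ?_⟩
    exact Prod.ext (transport_comp _ _ eA eA eC _ _) (transport_comp _ _ eC eB eB _ _)

/-- Both the bijection and its inverse are restrictions of linear maps of the ambient vector spaces.
-/
theorem E.equiv_isIsomorphism :
    (E.variety A B C).IsIsomorphism (E.variety A' B' C') (E.equiv F eA eB eC) :=
  ⟨(SpaceWithFunctions.isMorphism_linearMap (pairEquiv F eA eB eC).toLinearMap).induced _
      fun _ => rfl,
    (SpaceWithFunctions.isMorphism_linearMap (pairEquiv F eA eB eC).symm.toLinearMap).induced _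
      fun _ => rfl⟩

/-- The bijection `E.equiv` descends to the quotients. -/
theorem G.exists_equiv : ∃ Φ : G A B C ≃ G A' B' C',
    ∀ p : E A B C, Φ p.toG = (E.equiv F eA eB eC p).toG := by
  -- An arbitrary section of `E.toG`; by `E.toG_equiv_eq_iff` the resulting map does not depend on
  -- the choice.
  let s := Function.surjInv (E.toG_surjective A B C)
  have hs (S) : (s S).toG = S := Function.surjInv_eq _ S
  refine ⟨Equiv.ofBijective (fun S => (E.equiv F eA eB eC (s S)).toG) ⟨fun S T h => ?_, fun T => ?_⟩,
    fun p => (E.toG_equiv_eq_iff F eA eB eC _ _).2 (hs _)⟩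
  · rw [← hs S, ← hs T]
    exact (E.toG_equiv_eq_iff F eA eB eC _ _).1 h
  · obtain ⟨q, rfl⟩ := E.toG_surjective _ _ _ T
    obtain ⟨p, rfl⟩ := (E.equiv F eA eB eC).surjective q
    exact ⟨p.toG, (E.toG_equiv_eq_iff F eA eB eC _ _).2 (hs _)⟩

end Equivalence

theorem E.toG_arrow {𝒜 : Type u₁} [Category.{v₁} 𝒜] [Abelian 𝒜] {A B C : 𝒜} (p : E A B C) :
    ∃ i : (p.toG.1 : 𝒜) ≅ A, p.toG.1.arrow = i.hom ≫ p.1.1 :=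
  haveI : Mono p.1.1 := p.2.choose_spec.mono_f
  ⟨Subobject.underlyingIso p.1.1, (Subobject.underlyingIso_hom_comp_eq_mk p.1.1).symm⟩

end HallVariety

theorem proposition3p1
    {𝒜 : Type u₁} [Category.{v₁} 𝒜] [Abelian 𝒜] [Linear ℂ 𝒜] [HasDerivedCategory.{w₁} 𝒜]
    {ℬ : Type u₂} [Category.{v₂} ℬ] [Abelian ℬ] [Linear ℂ ℬ] [HasDerivedCategory.{w₂} ℬ]
    (h𝒜 : IsFiniteType 𝒜) (hℬ : IsFiniteType ℬ)
    (F : DerivedCategory.Bounded 𝒜 ⥤ DerivedCategory.Bounded ℬ)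
    [F.CommShift ℤ] [F.IsTriangulated] [F.Linear ℂ] [F.IsEquivalence]
    (A B C : 𝒜)
    (hA : (toDb ℬ).essImage (F.obj ((toDb 𝒜).obj A)))
    (hB : (toDb ℬ).essImage (F.obj ((toDb 𝒜).obj B)))
    (hG : Nonempty (G A B C)) :
    (toDb ℬ).essImage (F.obj ((toDb 𝒜).obj C)) ∧
    ∀ (A' B' C' : ℬ)
      (_ : F.obj ((toDb 𝒜).obj A) ≅ (toDb ℬ).obj A')
      (_ : F.obj ((toDb 𝒜).obj B) ≅ (toDb ℬ).obj B')
      (eC : F.obj ((toDb 𝒜).obj C) ≅ (toDb ℬ).obj C'),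
      ∃ Φ : G A B C ≃ G A' B' C',
        (∀ S : G A B C,
          ∃ e : F.obj ((toDb 𝒜).obj (S.1 : 𝒜)) ≅ (toDb ℬ).obj ((Φ S).1 : ℬ),
            e.hom ≫ (toDb ℬ).map (Φ S).1.arrow = F.map ((toDb 𝒜).map S.1.arrow) ≫ eC.hom) ∧
        (G.variety A B C).IsIsomorphism (G.variety A' B' C') Φ := by
  constructor
  · obtain ⟨S⟩ := hG
    obtain ⟨p, -⟩ := E.toG_surjective A B C S
    have H := (extendsToTriangle_toDb_iff p.1.1 p.1.2).2 p.2
    rw [← extendsToTriangle_map_iff F] at H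
    exact H.mem_essImage_toDb hA hB
  · intro A' B' C' eA eB eC
    obtain ⟨Φ, hΦ⟩ := G.exists_equiv F eA eB eC
    refine ⟨Φ, fun S => ?_, ?_, ?_⟩
    -- Representing the subobject by an exact sequence (α, β) replaces its inclusion by α up to
    -- isomorphism, and likewise in ℬ. The required square is then the defining property of the
    -- transport of α.
    · obtain ⟨p, rfl⟩ := E.toG_surjective A B C S
      obtain ⟨i, hi⟩ := E.toG_arrow p
      rw [hΦ, hi]
      obtain ⟨j, hj⟩ := E.toG_arrow (E.equiv F eA eB eC p)
      refine ⟨F.mapIso ((toDb 𝒜).mapIso i) ≪≫ eA ≪≫ (toDb ℬ).mapIso j.symm, ?_⟩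
      have h : eA.hom ≫ (toDb ℬ).map (E.equiv F eA eB eC p).1.1 =
          F.map ((toDb 𝒜).map p.1.1) ≫ eC.hom :=
        comp_map_transport (toDb 𝒜 ⋙ F) _ eA eC p.1.1
      rw [hj]
      simp [h]
    · exact (E.equiv_isIsomorphism F eA eB eC).1.quotient Φ hΦ
    · refine (E.equiv_isIsomorphism F eA eB eC).2.quotient Φ.symm fun q => ?_
      rw [Equiv.symm_apply_eq, hΦ, Equiv.apply_symm_apply]
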